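/- Let $\mathfrak H$ be a complex Hilbert space and let $A$ be an $m$-sectorial operator in $\mathfrak H$ with semi-angle $\alpha\in(0,\pi/2)$ and vertex $0$; that is, $A$ is a linear operator in $\mathfrak H$ whose numerical range $\{(Ax,x): x\in \mathrm{dom}\,A,\ \|x\|=1\}$ is contained in $\{z\in\mathbb C: |\arg z|\le\alpha\}$ (where $0$ is included in the sector), and $\zeta\mathbf 1+A$ has a bounded everywhere defined inverse for every $\zeta\in\mathbb C$ with $\operatorname{Re}\zeta>0$. Then $-A$ generates a semigroup $e^{-tA}$, holomorphic in operator norm for $t$ in the open sector $\{t\in\mathbb C: t\neq 0,\ |\arg t|<\pi/2-\alpha\}$ and strongly continuous at $t=0$ (with $e^{-0A}=\mathbf 1$) in every sector $|\arg t|<\theta'$ with $0<\theta'<\pi/2-\alpha$; and for every $t\in\mathbb C$ with $t=0$ or $|\arg t|<\pi/2-\alpha$, the operators $\mathbf 1+tA/n$, $n\ge 1$, have bounded everywhere defined inverses (for $t=0$, $\mathbf 1+tA/n$ is read as $\mathbf 1$) and, in the operator norm, $$\lim_{n\to\infty}\left\|(\mathbf 1+tA/n)^{-n}-e^{-tA}\right\|=0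 .$$ -/

import Mathlib

open Filter Topology

noncomputable section

namespace EulerFormula

/-- The closed sector of the numbers `z` with `|arg z| ≤ θ` (it contains `0`). -/
def closedSector (θ : ℝ) : Set ℂ := {z | |z.arg| ≤ θ}

/-- The open sector of the numbers `z ≠ 0` with `|arg z| < θ`. -/
def openSector (θ : ℝ) : Set ℂ := {z | z ≠ 0 ∧ |z.arg| < θ}

variable {H : Type*} [NormedAddCommGroup H] [InnerProductSpace ℂ H]

/-- The numerical range of a (possibly unbounded) operator: the numbers `(A x, x)` with `x` a unit
vector of the domain. (`inner` is linear in its second argument.) -/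
def numericalRange (A : H →ₗ.[ℂ] H) : Set ℂ :=
  {z | ∃ x : A.domain, ‖(x : H)‖ = 1 ∧ inner ℂ (x : H) (A x) = z}

/-- The bounded operator `R` is the two-sided inverse of the (possibly unbounded) operator `T`:
it maps `H` into the domain of `T`, `T R = 1` on `H` and `R T = 1` on the domain of `T`. -/
def IsBoundedInverse (T : H →ₗ.[ℂ] H) (R : H →L[ℂ] H) : Prop :=
  (∀ y : H, ∃ h : R y ∈ T.domain, T ⟨R y, h⟩ = y) ∧ ∀ x : T.domain, R (T x) = x

/-- `T` is boundedly invertible. -/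
def HasBoundedInverse (T : H →ₗ.[ℂ] H) : Prop := ∃ R : H →L[ℂ] H, IsBoundedInverse T R

open Classical in
/-- The bounded inverse of `T`, with the value `0` if `T` is not boundedly invertible. -/
def boundedInverse (T : H →ₗ.[ℂ] H) : H →L[ℂ] H :=
  if h : HasBoundedInverse T then h.choose else 0

/-- The operator `ζ + A`, with the domain of `A`. -/
def constAdd (ζ : ℂ) (A : H →ₗ.[ℂ] H) : H →ₗ.[ℂ] H :=
  (ζ • (LinearMap.id : H →ₗ[ℂ] H)) +ᵥ A

open Classical in
/-- The operator `1 + s A`, with the domain of `A` if `s ≠ 0`; for `s = 0` it is the identity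
operator of the whole space. -/
def onePlus (s : ℂ) (A : H →ₗ.[ℂ] H) : H →ₗ.[ℂ] H :=
  if s = 0 then (LinearMap.id : H →ₗ[ℂ] H).toPMap ⊤ else constAdd 1 (s • A)

/-- `A` is m-sectorial with semi-angle `α` and vertex `0`: its numerical range lies in the closed
sector `|arg z| ≤ α`, and `ζ + A` is boundedly invertible for all `ζ` with `0 < Re ζ`.
(For `α < π / 2` such an operator is closed and densely defined.) -/
structure IsMSectorial (A : H →ₗ.[ℂ] H) (α : ℝ) : Prop where
  numericalRange_subset : numericalRange A ⊆ closedSector α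
  hasBoundedInverse : ∀ ζ : ℂ, 0 < ζ.re → HasBoundedInverse (constAdd ζ A)

/-- The family `U z` is the holomorphic semigroup `e^{-zA}` on the open sector of semi-angle `θ`,
i.e. a semigroup that is holomorphic in operator norm on the open sector, strongly continuous at `0`
in every smaller sector, and whose generator is `-A` (as an equality of operators, domains
included). Only the values at `0` and on the open sector matter. -/
structure IsHolomorphicSemigroup (A : H →ₗ.[ℂ] H) (θ : ℝ) (U : ℂ → H →L[ℂ] H) : Prop where
  map_zero : U 0 = 1
  map_add : ∀ z ∈ openSector θ, ∀ w ∈ openSector θ, U (z + w) = U z * U w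
  holomorphic : DifferentiableOn ℂ U (openSector θ)
  tendsto_zero : ∀ θ' : ℝ, 0 < θ' → θ' < θ → ∀ x : H,
    Tendsto (fun z => U z x) (𝓝[openSector θ'] 0) (𝓝 x)
  generator : ∀ x y : H, (∃ h : x ∈ A.domain, A ⟨x, h⟩ = y) ↔
    Tendsto (fun t : ℝ => t⁻¹ • (x - U (t : ℂ) x)) (𝓝[>] 0) (𝓝 y)

end EulerFormula

end

/-! Write `R z` for `(1 + zA)⁻¹`. If `|arg z| < π/2 - α`, then `Re (z (Ax, x)) ≥ 0`, so `R z` is a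
contraction. Since `R` is holomorphic with `(R ^ k)' = -k A R ^ (k + 1)`, Cauchy's estimate on a
disc of radius `sρ` about `sz` bounds `A R(sz) ^ (k + 1)` by `1 / (k s ρ)`.

The Euler approximants `R(z/n)^n` and `R(z/m)^m` are the ends of the path `R((1-s)z/m)^m R(sz/n)^n`,
`0 < s < 1`. With `a = (1-s)z/m` and `b = sz/n`, its derivative is `z (b - a) A² R(a)^(m+1)
R(b)^(n+1)`. One of the two powers has a parameter at least half its full size and absorbs both
factors `A` at a cost independent of `m` and `n`, while `b - a` contributes `1/n + 1/m`. So the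
approximants are Cauchy in norm, locally uniformly in `z` (`norm_pow_sub_pow_le`), and their limit
`U` is holomorphic.

Passing to the limit in the resolvent identity gives `U'(z) U(w) = U(z) U'(w)`, which integrates to
the semigroup law. The same integration, applied to two semigroups with generator `-A`, proves
uniqueness (`eqOn`), so the convergence holds for any realisation of `e^{-tA}`. -/

noncomputable section

namespace EulerFormula

/-! ### Geometry of sectors -/

section Sector

variable {θ : ℝ}

theorem re_pos_of_mem_openSector (hθ : θ < Real.pi / 2) {z : ℂ} (hz : z ∈ openSector θ) :
    0 < z.re :=
  (Complex.abs_arg_lt_pi_div_two_iff.1 (hz.2.trans hθ)).resolve_right hz.1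

/-- Monotonicity of `tan` turns the condition on the argument into an inequality between continuous
sublinear expressions, from which openness and stability under addition are immediate. -/
theorem mem_openSector_iff (hθ₀ : 0 < θ) (hθ : θ < Real.pi / 2) {z : ℂ} :
    z ∈ openSector θ ↔ |z.im| * Real.cos θ < z.re * Real.sin θ := by
  have hc : 0 < Real.cos θ := Real.cos_pos_of_mem_Ioo ⟨by linarith, hθ⟩
  have hs : 0 < Real.sin θ := Real.sin_pos_of_pos_of_lt_pi hθ₀ (by linarith [Real.pi_pos])
  have key : ∀ {z : ℂ}, 0 < z.re →
      (|z.arg| < θ ↔ |z.im| * Real.cos θ < z.re * Real.sin θ) := by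
    intro z hz
    have hz' : |z.arg| < Real.pi / 2 := Complex.abs_arg_lt_pi_div_two_iff.2 (Or.inl hz)
    have h1 : Real.tan |z.arg| = |z.im| / z.re := by
      rcases abs_cases z.arg with ⟨h, h'⟩ | ⟨h, h'⟩
      · rw [h, Complex.tan_arg, abs_of_nonneg (Complex.arg_nonneg_iff.1 h')]
      · rw [h, Real.tan_neg, Complex.tan_arg, abs_of_neg (Complex.arg_neg_iff.1 h'), neg_div]
    rw [← Real.strictMonoOn_tan.lt_iff_lt (a := |z.arg|) (b := θ)
      ⟨by linarith [abs_nonneg z.arg, Real.pi_pos], hz'⟩ ⟨by linarith, hθ⟩, h1,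
      Real.tan_eq_sin_div_cos, div_lt_div_iff₀ hz hc, mul_comm z.re]
  constructor
  · intro h
    exact (key (re_pos_of_mem_openSector hθ h)).1 h.2
  · intro h
    have hz : 0 < z.re := by
      have : 0 < z.re * Real.sin θ := lt_of_le_of_lt (by positivity) h
      exact (pos_iff_pos_of_mul_pos this).2 hs
    refine ⟨?_, (key hz).2 h⟩
    rintro rfl
    simp at hz

theorem pos_of_mem_openSector {z : ℂ} (hz : z ∈ openSector θ) : 0 < θ :=
  (abs_nonneg _).trans_lt hz.2

theorem isOpen_openSector (hθ : θ < Real.pi / 2) : IsOpen (openSector θ) := by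
  rcases le_or_gt θ 0 with h | h
  · convert isOpen_empty
    ext z
    exact ⟨fun hz => absurd (pos_of_mem_openSector hz) h.not_gt, fun h => h.elim⟩
  · have : openSector θ = {z : ℂ | |z.im| * Real.cos θ < z.re * Real.sin θ} :=
      Set.ext fun z => mem_openSector_iff h hθ
    rw [this]
    exact isOpen_lt (by fun_prop) (by fun_prop)

theorem add_mem_openSector (hθ : θ < Real.pi / 2) {z w : ℂ} (hz : z ∈ openSector θ)
    (hw : w ∈ openSector θ) : z + w ∈ openSector θ := by
  have h := pos_of_mem_openSector hz
  rw [mem_openSector_iff h hθ] at *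
  have hc : 0 < Real.cos θ := Real.cos_pos_of_mem_Ioo ⟨by linarith, hθ⟩
  have := mul_le_mul_of_nonneg_right (abs_add_le z.im w.im) hc.le
  simp only [Complex.add_re, Complex.add_im]
  linarith

theorem ofReal_mul_mem_openSector {z : ℂ} (hz : z ∈ openSector θ) {s : ℝ} (hs : 0 < s) :
    (s : ℂ) * z ∈ openSector θ :=
  ⟨mul_ne_zero (by exact_mod_cast hs.ne') hz.1, by rw [Complex.arg_real_mul _ hs]; exact hz.2⟩

theorem div_natCast_mem_openSector {z : ℂ} (hz : z ∈ openSector θ) {n : ℕ} (hn : n ≠ 0) :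
    z / n ∈ openSector θ := by
  have h := ofReal_mul_mem_openSector hz (s := (n : ℝ)⁻¹) (by positivity)
  rwa [Complex.ofReal_inv, Complex.ofReal_natCast, inv_mul_eq_div] at h

theorem ofReal_mem_openSector (hθ : 0 < θ) {s : ℝ} (hs : 0 < s) : (s : ℂ) ∈ openSector θ :=
  ⟨by exact_mod_cast hs.ne', by rwa [Complex.arg_ofReal_of_nonneg hs.le, abs_zero]⟩

theorem add_ofReal_mul_mem_openSector (hθ : θ < Real.pi / 2) {z w : ℂ} (hz : z ∈ openSector θ)
    (hw : w ∈ openSector θ) {s : ℝ} (hs : 0 ≤ s) : z + s * w ∈ openSector θ := by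
  rcases hs.eq_or_lt with rfl | hs
  · simpa using hz
  · exact add_mem_openSector hθ hz (ofReal_mul_mem_openSector hw hs)

theorem closedBall_smul_subset_openSector {z : ℂ} {ρ : ℝ}
    (h : Metric.closedBall z ρ ⊆ openSector θ) {s : ℝ} (hs : 0 < s) :
    Metric.closedBall ((s : ℂ) * z) (s * ρ) ⊆ openSector θ := by
  intro w hw
  have hs' : (s : ℂ) ≠ 0 := by exact_mod_cast hs.ne'
  have : ((s⁻¹ : ℝ) : ℂ) * w ∈ Metric.closedBall z ρ := by
    rw [mem_closedBall_iff_norm] at hw ⊢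
    have e : ((s⁻¹ : ℝ) : ℂ) * w - z = ((s⁻¹ : ℝ) : ℂ) * (w - s * z) := by
      push_cast; field_simp
    rw [e, norm_mul, Complex.norm_real, Real.norm_of_nonneg (by positivity), inv_mul_le_iff₀ hs]
    exact hw
  have := ofReal_mul_mem_openSector (h this) hs
  rwa [Complex.ofReal_inv, mul_inv_cancel_left₀ hs'] at this

theorem re_mul_nonneg {α : ℝ} (hα₀ : 0 < α) (hα : α < Real.pi / 2) {t z : ℂ}
    (ht : t ∈ openSector (Real.pi / 2 - α)) (hz : z ∈ closedSector α) : 0 ≤ (t * z).re := by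
  rw [← Complex.abs_arg_le_pi_div_two_iff]
  rcases eq_or_ne z 0 with rfl | hz0
  · simp; positivity
  have h1 := ht.2
  have h2 : |z.arg| ≤ α := hz
  have h3 : |t.arg + z.arg| ≤ Real.pi / 2 := (abs_add_le _ _).trans (by linarith)
  have h4 := abs_le.1 h3
  rw [Complex.arg_mul ht.1 hz0 ⟨by linarith [Real.pi_pos], by linarith [Real.pi_pos]⟩]
  exact h3

end Sector

/-! ### Abstract resolvent families and Cauchy estimates -/

section ResolventFamily

variable {E : Type*} [NormedRing E] [NormedAlgebra ℂ E] {θ : ℝ}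

/-- A family that behaves like `R z = (1 + z A)⁻¹` for an operator `A` with contractive `R z`. -/
structure IsContractiveResolvent (θ : ℝ) (R : ℂ → E) : Prop where
  norm_le : ∀ z ∈ openSector θ, ‖R z‖ ≤ 1
  smul_sub_smul : ∀ a ∈ openSector θ, ∀ b ∈ openSector θ,
    b • R b - a • R a = (b - a) • (R a * R b)

/-- The counterpart of `A (1 + z A)⁻¹` for a family `R z = (1 + z A)⁻¹`. -/
def cofactor (R : ℂ → E) (z : ℂ) : E := z⁻¹ • (1 - R z)

theorem smul_cofactor (R : ℂ → E) {z : ℂ} (hz : z ≠ 0) : z • cofactor R z = 1 - R z := by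
  rw [cofactor, smul_inv_smul₀ hz]

namespace IsContractiveResolvent

variable {R : ℂ → E} {a b z : ℂ}

/-- Exchanging `a` and `b` changes the sign of both sides of the resolvent identity except for the
order of the product. -/
theorem commute (hR : IsContractiveResolvent θ R) (ha : a ∈ openSector θ)
    (hb : b ∈ openSector θ) : Commute (R a) (R b) := by
  rcases eq_or_ne a b with rfl | hab
  · exact Commute.refl _
  have h1 := hR.smul_sub_smul a ha b hb
  have h2 := hR.smul_sub_smul b hb a ha
  refine (smul_right_injective E (sub_ne_zero.2 hab.symm)) ?_
  change (b - a) • (R a * R b) = (b - a) • (R b * R a)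
  rw [← h1, ← neg_sub a b, neg_smul, ← h2, neg_sub]

theorem commute_cofactor (hR : IsContractiveResolvent θ R) (ha : a ∈ openSector θ)
    (hb : b ∈ openSector θ) : Commute (R a) (cofactor R b) :=
  ((Commute.one_right _).sub_right (hR.commute ha hb)).smul_right _

theorem commute_cofactor_cofactor (hR : IsContractiveResolvent θ R) (ha : a ∈ openSector θ)
    (hb : b ∈ openSector θ) : Commute (cofactor R a) (cofactor R b) :=
  ((Commute.one_left _).sub_left (hR.commute_cofactor ha hb)).smul_left _

theorem sub_eq (hR : IsContractiveResolvent θ R) (ha : a ∈ openSector θ)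
    (hb : b ∈ openSector θ) : R a - R b = (b - a) • (cofactor R a * R b) := by
  refine (smul_right_injective E ha.1) ?_
  change a • (R a - R b) = a • ((b - a) • (cofactor R a * R b))
  rw [smul_comm, ← smul_mul_assoc, smul_cofactor R ha.1, sub_mul, one_mul,
    smul_sub, smul_sub (b - a), ← hR.smul_sub_smul a ha b hb]
  module

theorem cofactor_mul (hR : IsContractiveResolvent θ R) (ha : a ∈ openSector θ)
    (hb : b ∈ openSector θ) : cofactor R a * R b = R a * cofactor R b := by
  rcases eq_or_ne a b with rfl | hab
  · exact (hR.commute_cofactor ha ha).symm.eq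
  have h1 := hR.sub_eq ha hb
  have h2 := hR.sub_eq hb ha
  refine (smul_right_injective E (sub_ne_zero.2 hab.symm)) ?_
  change (b - a) • (cofactor R a * R b) = (b - a) • (R a * cofactor R b)
  rw [← h1, (hR.commute_cofactor ha hb).eq, ← neg_sub a b, neg_smul, ← h2, neg_sub]

theorem cofactor_sub (hR : IsContractiveResolvent θ R) (ha : a ∈ openSector θ)
    (hb : b ∈ openSector θ) :
    cofactor R a - cofactor R b = (b - a) • (cofactor R a * cofactor R b) := by
  refine (smul_right_injective E hb.1) ?_
  change b • (cofactor R a - cofactor R b) = b • ((b - a) • (cofactor R a * cofactor R b))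
  rw [smul_comm, ← mul_smul_comm, smul_sub, smul_cofactor R hb.1, mul_sub, mul_one, smul_sub,
    ← hR.sub_eq ha hb, sub_smul, smul_cofactor R ha.1]
  abel

theorem norm_pow_le (hR : IsContractiveResolvent θ R) (ha : a ∈ openSector θ) {n : ℕ}
    (hn : 0 < n) : ‖R a ^ n‖ ≤ 1 :=
  (norm_pow_le' _ hn).trans (pow_le_one₀ (norm_nonneg _) (hR.norm_le a ha))

/-- By `sub_eq` the slope at `a` is exactly `-(cofactor R a * R w)`, so only continuity is needed;
that follows from `sub_eq` and contractivity. -/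
theorem hasDerivAt (hθ : θ < Real.pi / 2) (hR : IsContractiveResolvent θ R)
    (ha : a ∈ openSector θ) : HasDerivAt R (-(cofactor R a * R a)) a := by
  have hS : openSector θ ∈ 𝓝 a := (isOpen_openSector hθ).mem_nhds ha
  have hc : ContinuousAt R a := by
    rw [ContinuousAt, tendsto_iff_norm_sub_tendsto_zero]
    have h0 : Tendsto (fun w => ‖a - w‖ * ‖cofactor R a‖) (𝓝 a) (𝓝 0) := by
      have : Continuous (fun w => ‖a - w‖ * ‖cofactor R a‖) := by fun_prop
      simpa using this.tendsto a
    refine squeeze_zero' (.of_forall fun _ => norm_nonneg _) ?_ h0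
    filter_upwards [hS] with w hw
    rw [norm_sub_rev, hR.sub_eq ha hw, norm_smul, norm_sub_rev]
    gcongr
    refine (norm_mul_le _ _).trans ?_
    exact mul_le_of_le_one_right (norm_nonneg _) (hR.norm_le w hw)
  rw [hasDerivAt_iff_tendsto_slope]
  have h1 : Tendsto (fun w => -(cofactor R a * R w)) (𝓝[≠] a) (𝓝 (-(cofactor R a * R a))) :=
    ((tendsto_const_nhds.mul hc.tendsto).neg).mono_left nhdsWithin_le_nhds
  refine h1.congr' ?_
  filter_upwards [mem_nhdsWithin_of_mem_nhds hS, self_mem_nhdsWithin] with w hw hne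
  have hne' : w - a ≠ 0 := sub_ne_zero.2 hne
  rw [slope, vsub_eq_sub, ← neg_sub (R a) (R w), hR.sub_eq ha hw, smul_neg, inv_smul_smul₀ hne']

theorem hasDerivAt_pow (hθ : θ < Real.pi / 2) (hR : IsContractiveResolvent θ R)
    (ha : a ∈ openSector θ) (n : ℕ) :
    HasDerivAt (fun w => R w ^ n) (-((n : ℂ) • (cofactor R a * R a ^ n))) a := by
  induction n with
  | zero => simpa using hasDerivAt_const a (1 : E)
  | succ n ih =>
    have h := ih.mul (hR.hasDerivAt hθ ha)
    simp only [pow_succ]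
    refine h.congr_deriv ?_
    have hc := (hR.commute_cofactor ha ha).pow_left n
    rw [mul_neg, ← mul_assoc (R a ^ n), hc.eq, neg_mul, smul_mul_assoc, mul_assoc]
    push_cast
    module

/-- Cauchy's estimate for the derivative of `R ^ k`. -/
theorem norm_cofactor_mul_pow_le [CompleteSpace E] (hθ : θ < Real.pi / 2)
    (hR : IsContractiveResolvent θ R) {ρ : ℝ} (hρ : 0 < ρ)
    (hz : Metric.closedBall z ρ ⊆ openSector θ) {s : ℝ} (hs : 0 < s) {k : ℕ} (hk : 0 < k) :
    ‖cofactor R (s * z) * R (s * z) ^ k‖ ≤ 1 / (k * s * ρ) := by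
  have hsub := closedBall_smul_subset_openSector hz hs
  have hsρ : 0 < s * ρ := by positivity
  have hmem : (s : ℂ) * z ∈ openSector θ := hsub (Metric.mem_closedBall_self hsρ.le)
  have hd : DiffContOnCl ℂ (fun w => R w ^ k) (Metric.ball ((s : ℂ) * z) (s * ρ)) := by
    refine DifferentiableOn.diffContOnCl fun w hw => ?_
    have hw' := hsub (Metric.closure_ball_subset_closedBall hw)
    exact (hR.hasDerivAt_pow hθ hw' k).differentiableAt.differentiableWithinAt
  have h := Complex.norm_deriv_le_of_forall_mem_sphere_norm_le hsρ hd (C := 1) fun w hw =>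
    hR.norm_pow_le (hsub (Metric.sphere_subset_closedBall hw)) hk
  rw [(hR.hasDerivAt_pow hθ hmem k).deriv, norm_neg, norm_smul, Complex.norm_natCast] at h
  have hk' : (0 : ℝ) < k := by exact_mod_cast hk
  rw [le_div_iff₀ hsρ] at h
  rw [le_div_iff₀ (by positivity)]
  linarith

/-- Two factors `A` are absorbed by a power of one resolvent. -/
theorem norm_cofactor_mul_cofactor_mul_le [CompleteSpace E] (hθ : θ < Real.pi / 2)
    (hR : IsContractiveResolvent θ R) {ρ : ℝ} (hρ : 0 < ρ)
    (hz : Metric.closedBall z ρ ⊆ openSector θ) {s : ℝ} (hs : 0 < s) {n : ℕ} (hn : 3 ≤ n)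
    (ha : a ∈ openSector θ) (m : ℕ) :
    ‖cofactor R a * cofactor R (s * z) * (R a ^ m * R (s * z) ^ n)‖ ≤ (4 / (n * s * ρ)) ^ 2 := by
  have hb : (s : ℂ) * z ∈ openSector θ :=
    ofReal_mul_mem_openSector (hz (Metric.mem_closedBall_self hρ.le)) hs
  -- One of the `n` factors `R (s z)` is spent on moving the `A` of `cofactor R a` over to `s z`.
  -- The other `n - 1` are split into two nearly equal powers, one per factor `A`; for `n ≥ 3` each
  -- exponent is at least `n / 4`, whence the constant `4`.
  obtain ⟨k, l, hkl, hk, hl⟩ : ∃ k l : ℕ, n = 1 + k + l ∧ n ≤ 4 * k ∧ n ≤ 4 * l :=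
    ⟨(n - 1) / 2, n - 1 - (n - 1) / 2, by omega, by omega, by omega⟩
  set B := cofactor R (s * z)
  set Q := R (s * z)
  have hBQ : Commute Q B := hR.commute_cofactor hb hb
  have hPB : Commute (R a) B := hR.commute_cofactor ha hb
  have hPQ : Commute (R a) Q := hR.commute ha hb
  have e : cofactor R a * B * (R a ^ m * Q ^ n) = R a ^ (m + 1) * ((B * Q ^ k) * (B * Q ^ l)) := by
    calc cofactor R a * B * (R a ^ m * Q ^ n)
        = cofactor R a * (B * R a ^ m) * Q ^ n := by simp only [mul_assoc]
      _ = cofactor R a * (R a ^ m * B) * Q ^ n := by rw [(hPB.pow_left m).eq]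
      _ = (cofactor R a * R a ^ m) * B * (Q * Q ^ k * Q ^ l) := by
          rw [hkl, pow_add, pow_add, pow_one]; simp only [mul_assoc]
      _ = R a ^ m * cofactor R a * (B * Q) * Q ^ k * Q ^ l := by
          rw [((hR.commute_cofactor ha ha).pow_left m).eq]; simp only [mul_assoc]
      _ = R a ^ m * (cofactor R a * Q) * B * Q ^ k * Q ^ l := by
          rw [← hBQ.eq]; simp only [mul_assoc]
      _ = R a ^ m * R a * B * (B * Q ^ k) * Q ^ l := by
          rw [hR.cofactor_mul ha hb]; simp only [mul_assoc]; rfl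
      _ = R a ^ (m + 1) * ((B * Q ^ k) * (B * Q ^ l)) := by
          rw [← (hBQ.pow_left k).eq, pow_succ]
          simp only [mul_assoc]
          rw [← mul_assoc B (Q ^ k), ← (hBQ.pow_left k).eq]
          simp only [mul_assoc]
  have hest : ∀ k : ℕ, n ≤ 4 * k → ‖B * Q ^ k‖ ≤ 4 / (n * s * ρ) := by
    intro k hk
    refine (hR.norm_cofactor_mul_pow_le hθ hρ hz hs (by omega)).trans ?_
    have hk0 : (0 : ℝ) < k := by exact_mod_cast (by omega : 0 < k)
    have hn0 : (0 : ℝ) < n := by exact_mod_cast (by omega : 0 < n)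
    have hk' : (n : ℝ) ≤ 4 * k := by exact_mod_cast hk
    rw [div_le_div_iff₀ (by positivity) (by positivity)]
    have := mul_le_mul_of_nonneg_right hk' (by positivity : 0 ≤ s * ρ)
    linarith
  rw [e, sq]
  calc ‖R a ^ (m + 1) * ((B * Q ^ k) * (B * Q ^ l))‖
      ≤ ‖R a ^ (m + 1)‖ * (‖B * Q ^ k‖ * ‖B * Q ^ l‖) :=
        (norm_mul_le _ _).trans (by gcongr; exact norm_mul_le _ _)
    _ ≤ 1 * (4 / (n * s * ρ) * (4 / (n * s * ρ))) := by
        gcongr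
        · exact hR.norm_pow_le ha (Nat.succ_pos m)
        · exact hest k hk
        · exact hest l hl
    _ = _ := one_mul _

end IsContractiveResolvent
end ResolventFamily

theorem hasDerivAt_comp_line {F : Type*} [NormedAddCommGroup F] [NormedSpace ℂ F] {f : ℂ → F}
    {f' : F} {c v : ℂ} {t : ℝ} (hf : HasDerivAt f f' (c + t * v)) :
    HasDerivAt (fun s : ℝ => f (c + s * v)) (v • f') t := by
  have h : HasDerivAt (fun s : ℝ => c + (s : ℂ) * v) v t := by
    simpa using ((Complex.ofRealCLM.hasDerivAt (x := t)).mul_const v).const_add c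
  exact hf.scomp t h

/-! ### Interpolation between two Euler approximants -/

namespace IsContractiveResolvent

variable {E : Type*} [NormedRing E] [NormedAlgebra ℂ E] [CompleteSpace E] {θ : ℝ}
  {R : ℂ → E} {z : ℂ}

/-- Mean value inequality along the interpolating path. The interval is open because `R` is
controlled only on the open sector, which excludes `0`; the ends are reached later by strong limits.
-/
theorem norm_interpolation_sub_le (hθ : θ < Real.pi / 2)
    (hR : IsContractiveResolvent θ R) {ρ : ℝ} (hρ : 0 < ρ)
    (hz : Metric.closedBall z ρ ⊆ openSector θ) {m n : ℕ} (hm : 3 ≤ m) (hn : 3 ≤ n)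
    {s t : ℝ} (hs : s ∈ Set.Ioo (0 : ℝ) 1) (ht : t ∈ Set.Ioo (0 : ℝ) 1) :
    ‖R (((1 - t : ℝ) : ℂ) * (z / m)) ^ m * R ((t : ℂ) * (z / n)) ^ n -
      R (((1 - s : ℝ) : ℂ) * (z / m)) ^ m * R ((s : ℂ) * (z / n)) ^ n‖ ≤
      64 * ‖z‖ ^ 2 / ρ ^ 2 * (1 / n + 1 / m) := by
  have hm0 : (0 : ℝ) < m := by exact_mod_cast (by omega : 0 < m)
  have hn0 : (0 : ℝ) < n := by exact_mod_cast (by omega : 0 < n)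
  have hmC : (m : ℂ) ≠ 0 := by exact_mod_cast hm0.ne'
  have hnC : (n : ℂ) ≠ 0 := by exact_mod_cast hn0.ne'
  have hzS := hz (Metric.mem_closedBall_self hρ.le)
  have hzm : z / m ∈ openSector θ := div_natCast_mem_openSector hzS (by omega)
  have hzn : z / n ∈ openSector θ := div_natCast_mem_openSector hzS (by omega)
  set K := 64 * ‖z‖ ^ 2 / ρ ^ 2 * (1 / n + 1 / m) with hK
  have hK0 : 0 ≤ K := by positivity
  have key : ∀ s ∈ Set.Ioo (0 : ℝ) 1, ∃ D : E, HasDerivAt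
      (fun s : ℝ => R (((1 - s : ℝ) : ℂ) * (z / m)) ^ m * R ((s : ℂ) * (z / n)) ^ n) D s ∧
      ‖D‖ ≤ K := by
    intro s hs
    set a : ℂ := ((1 - s : ℝ) : ℂ) * (z / m) with ha
    set b : ℂ := (s : ℂ) * (z / n) with hb
    have haS : a ∈ openSector θ := ofReal_mul_mem_openSector hzm (by linarith [hs.2])
    have hbS : b ∈ openSector θ := ofReal_mul_mem_openSector hzn hs.1
    have h1 : HasDerivAt (fun s : ℝ => R (((1 - s : ℝ) : ℂ) * (z / m)) ^ m)
        (z • (cofactor R a * R a ^ m)) s := by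
      have e : ∀ s : ℝ, ((1 - s : ℝ) : ℂ) * (z / m) = z / m + s * (-(z / m)) := fun s => by
        push_cast; ring
      have h := hasDerivAt_comp_line (f := fun w => R w ^ m) (c := z / m) (v := -(z / m)) (t := s)
        (by rw [← e]; exact hR.hasDerivAt_pow hθ haS m)
      simp only [← e] at h
      refine h.congr_deriv ?_
      rw [smul_neg, neg_smul, neg_neg, smul_smul, div_mul_cancel₀ _ hmC]
    have h2 : HasDerivAt (fun s : ℝ => R ((s : ℂ) * (z / n)) ^ n)
        (-(z • (cofactor R b * R b ^ n))) s := by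
      have h := hasDerivAt_comp_line (f := fun w => R w ^ n) (c := 0) (v := z / n) (t := s)
        (by rw [zero_add]; exact hR.hasDerivAt_pow hθ hbS n)
      simp only [zero_add] at h
      refine h.congr_deriv ?_
      rw [smul_neg, smul_smul, div_mul_cancel₀ _ hnC]
    refine ⟨_, h1.fun_mul h2, ?_⟩
    -- The two terms combine into a difference of cofactors, which the resolvent identity turns into
    -- `b - a` times their product.
    have e1 : z • (cofactor R a * R a ^ m) * R b ^ n + R a ^ m * -(z • (cofactor R b * R b ^ n)) =
        (z * (b - a)) • (cofactor R a * cofactor R b * (R a ^ m * R b ^ n)) := by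
      rw [mul_smul, ← smul_mul_assoc (b - a), ← hR.cofactor_sub haS hbS, mul_neg, mul_smul_comm,
        ← mul_assoc (R a ^ m), ((hR.commute_cofactor haS hbS).pow_left m).eq, smul_mul_assoc,
        sub_mul]
      simp only [mul_assoc, sub_eq_add_neg, smul_add, smul_neg]
    have e2 : ‖cofactor R a * cofactor R b * (R a ^ m * R b ^ n)‖ ≤ (8 / ρ) ^ 2 := by
      -- The power whose parameter is at least half of its full size does the absorbing: `4 / s ≤ 8`
      -- or `4 / (1 - s) ≤ 8`. Squaring `8 / ρ` gives the constant `64`.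
      rcases le_total (1 / 2) s with h | h
      · have hb' : b = ((s / n : ℝ) : ℂ) * z := by rw [hb]; push_cast; ring
        have hle := hR.norm_cofactor_mul_cofactor_mul_le hθ hρ hz (div_pos hs.1 hn0) hn haS m
        rw [← hb'] at hle
        refine hle.trans ?_
        rw [mul_div_cancel₀ _ hn0.ne']
        have hs0 := hs.1
        gcongr ?_ ^ 2
        rw [div_le_div_iff₀ (by positivity) hρ]
        nlinarith
      · have hs0 : 0 < 1 - s := by linarith [hs.2]
        have ha' : a = (((1 - s) / m : ℝ) : ℂ) * z := by rw [ha]; push_cast; ring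
        have hle := hR.norm_cofactor_mul_cofactor_mul_le hθ hρ hz (div_pos hs0 hm0) hm hbS n
        rw [← ha'] at hle
        rw [(hR.commute_cofactor_cofactor haS hbS).eq, ((hR.commute haS hbS).pow_pow m n).eq]
        refine hle.trans ?_
        rw [mul_div_cancel₀ _ hm0.ne']
        gcongr ?_ ^ 2
        rw [div_le_div_iff₀ (by positivity) hρ]
        nlinarith
    have e3 : ‖b - a‖ ≤ ‖z‖ * (1 / n + 1 / m) := by
      have hb' : ‖b‖ ≤ ‖z‖ * (1 / n) := by
        rw [hb, norm_mul, norm_div, Complex.norm_natCast, Complex.norm_real,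
          Real.norm_of_nonneg hs.1.le, mul_one_div]
        exact mul_le_of_le_one_left (by positivity) hs.2.le
      have ha' : ‖a‖ ≤ ‖z‖ * (1 / m) := by
        rw [ha, norm_mul, norm_div, Complex.norm_natCast, Complex.norm_real,
          Real.norm_of_nonneg (by linarith [hs.2]), mul_one_div]
        exact mul_le_of_le_one_left (by positivity) (by linarith [hs.1])
      rw [mul_add]
      exact (norm_sub_le _ _).trans (add_le_add hb' ha')
    rw [e1, norm_smul, norm_mul]
    calc ‖z‖ * ‖b - a‖ * ‖cofactor R a * cofactor R b * (R a ^ m * R b ^ n)‖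
        ≤ ‖z‖ * (‖z‖ * (1 / n + 1 / m)) * (8 / ρ) ^ 2 := by gcongr
      _ = K := by rw [hK]; ring
  choose! D hD hDle using key
  have h := (convex_Ioo (0 : ℝ) 1).norm_image_sub_le_of_norm_hasDerivWithin_le
    (fun s hs => (hD s hs).hasDerivWithinAt) hDle hs ht
  refine h.trans (mul_le_of_le_one_right hK0 ?_)
  rw [Real.norm_eq_abs, abs_le]
  constructor <;> linarith [hs.1, hs.2, ht.1, ht.2]

end IsContractiveResolvent

/-! ### Functional equation from a relation between derivatives -/

section Segment

variable {E : Type*} [NormedRing E] [NormedAlgebra ℂ E] {θ : ℝ}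

/-- The path `s ↦ U (z + c - s c) * V (w + s c)` has zero derivative on `[0, 1]`; its end values are
compared. -/
theorem mul_eq_mul_of_deriv_mul_eq (hθ : θ < Real.pi / 2) {U V : ℂ → E}
    (hU : DifferentiableOn ℂ U (openSector θ)) (hV : DifferentiableOn ℂ V (openSector θ))
    (h : ∀ z ∈ openSector θ, ∀ w ∈ openSector θ, deriv U z * V w = U z * deriv V w)
    {z w c : ℂ} (hz : z ∈ openSector θ) (hw : w ∈ openSector θ) (hc : c ∈ openSector θ) :
    U (z + c) * V w = U z * V (w + c) := by
  have hd : ∀ s ∈ Set.Icc (0 : ℝ) 1, HasDerivAt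
      (fun s : ℝ => U (z + c + s * (-c)) * V (w + s * c)) 0 s := by
    intro s hs
    have hz' : z + c + s * (-c) ∈ openSector θ := by
      have := add_ofReal_mul_mem_openSector hθ hz hc (s := 1 - s) (by linarith [hs.2])
      convert this using 1
      push_cast; ring
    have hw' := add_ofReal_mul_mem_openSector hθ hw hc hs.1
    have hS := isOpen_openSector hθ
    have h1 := hasDerivAt_comp_line (hU.differentiableAt (hS.mem_nhds hz')).hasDerivAt
    have h2 := hasDerivAt_comp_line (hV.differentiableAt (hS.mem_nhds hw')).hasDerivAt
    refine (h1.fun_mul h2).congr_deriv ?_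
    rw [smul_mul_assoc, h _ hz' _ hw', mul_smul_comm, neg_smul, neg_add_cancel]
  have := constant_of_has_deriv_right_zero
    (fun s hs => (hd s hs).continuousAt.continuousWithinAt)
    (fun s hs => (hd s (Set.Ico_subset_Icc_self hs)).hasDerivWithinAt) 1 (by simp)
  simpa using this.symm

end Segment

/-! ### Strong convergence -/

section StrongConvergence

variable {H : Type*} [NormedAddCommGroup H] [InnerProductSpace ℂ H]

theorem tendsto_clm_apply {ι : Type*} {l : Filter ι} {P : ι → H →L[ℂ] H} {T : H →L[ℂ] H}
    (hP : Tendsto P l (𝓝 T)) (x : H) : Tendsto (fun i => P i x) l (𝓝 (T x)) :=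
  ((ContinuousLinearMap.apply ℂ H x).continuous.tendsto T).comp hP

theorem tendsto_apply_of_norm_le {ι : Type*} {l : Filter ι} {P : ι → H →L[ℂ] H} {v : ι → H}
    {y w : H} (hP : ∀ᶠ i in l, ‖P i‖ ≤ 1) (hy : Tendsto (fun i => P i y) l (𝓝 w))
    (hv : Tendsto v l (𝓝 y)) : Tendsto (fun i => P i (v i)) l (𝓝 w) := by
  have h0 : Tendsto (fun i => P i (v i - y)) l (𝓝 0) := by
    refine squeeze_zero_norm' ?_ (tendsto_iff_norm_sub_tendsto_zero.1 hv)
    filter_upwards [hP] with i hi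
    exact ((P i).le_opNorm _).trans (mul_le_of_le_one_left (norm_nonneg _) hi)
  simpa using h0.add hy

end StrongConvergence

/-! ### Norm convergence of the Euler approximants -/

namespace IsContractiveResolvent

variable {H : Type*} [NormedAddCommGroup H] [InnerProductSpace ℂ H] {θ : ℝ}
  {R U : ℂ → H →L[ℂ] H} {z w : ℂ}

theorem tendsto_pow_apply (hR : IsContractiveResolvent θ R)
    (hR₀ : ∀ z ∈ openSector θ, ∀ x, Tendsto (fun s : ℝ => R (s * z) x) (𝓝[>] 0) (𝓝 x))
    (hz : z ∈ openSector θ) (x : H) (n : ℕ) :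
    Tendsto (fun s : ℝ => (R (s * z) ^ n) x) (𝓝[>] 0) (𝓝 x) := by
  induction n with
  | zero => simp
  | succ n ih =>
    simp only [pow_succ', mul_apply_eq_comp]
    refine tendsto_apply_of_norm_le (P := fun s : ℝ => R (s * z)) ?_ (hR₀ z hz x) ih
    filter_upwards [self_mem_nhdsWithin] with s hs
    exact hR.norm_le _ (ofReal_mul_mem_openSector hz hs)

variable [CompleteSpace H]

/-- As `s → 0`, `R (s z)` tends to `1` only strongly. The interpolation bound is therefore applied
to a fixed vector before the path parameters go to `0` and `1`, which still yields an operator norm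
bound. -/
theorem norm_pow_sub_pow_le (hθ : θ < Real.pi / 2) (hR : IsContractiveResolvent θ R)
    (hR₀ : ∀ z ∈ openSector θ, ∀ x, Tendsto (fun s : ℝ => R (s * z) x) (𝓝[>] 0) (𝓝 x))
    {ρ : ℝ} (hρ : 0 < ρ) (hz : Metric.closedBall z ρ ⊆ openSector θ) {m n : ℕ}
    (hm : 3 ≤ m) (hn : 3 ≤ n) :
    ‖R (z / n) ^ n - R (z / m) ^ m‖ ≤ 64 * ‖z‖ ^ 2 / ρ ^ 2 * (1 / n + 1 / m) := by
  have hzS := hz (Metric.mem_closedBall_self hρ.le)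
  have hzm : z / m ∈ openSector θ := div_natCast_mem_openSector hzS (by omega)
  have hzn : z / n ∈ openSector θ := div_natCast_mem_openSector hzS (by omega)
  refine ContinuousLinearMap.opNorm_le_bound _ (by positivity) fun x => ?_
  have hI : ∀ᶠ s : ℝ in 𝓝[>] 0, s ∈ Set.Ioo (0 : ℝ) 1 := Ioo_mem_nhdsGT one_pos
  have hone : ∀ {k : ℕ}, z / k ∈ openSector θ →
      Tendsto (fun s : ℝ => (R (((1 - s : ℝ) : ℂ) * (z / k)) ^ k) x) (𝓝[>] 0)
        (𝓝 ((R (z / k) ^ k) x)) := by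
    intro k hk
    have hc : ContinuousAt (fun w => R w ^ k) (((1 - (0 : ℝ) : ℝ) : ℂ) * (z / k)) := by
      simpa using (hR.hasDerivAt_pow hθ hk k).continuousAt
    have hl : ContinuousAt (fun s : ℝ => ((1 - s : ℝ) : ℂ) * (z / k)) 0 := by fun_prop
    have hcl : Tendsto (fun s : ℝ => R (((1 - s : ℝ) : ℂ) * (z / k)) ^ k) (𝓝 0)
        (𝓝 (R (z / k) ^ k)) := by
      have := hc.tendsto.comp hl.tendsto
      rwa [sub_zero, Complex.ofReal_one, one_mul] at this
    exact (tendsto_clm_apply hcl x).mono_left nhdsWithin_le_nhds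
  have h1 : Tendsto (fun s : ℝ => (R ((s : ℂ) * (z / m)) ^ m)
      ((R (((1 - s : ℝ) : ℂ) * (z / n)) ^ n) x)) (𝓝[>] 0) (𝓝 ((R (z / n) ^ n) x)) := by
    refine tendsto_apply_of_norm_le ?_ (hR.tendsto_pow_apply hR₀ hzm _ m) (hone hzn)
    filter_upwards [hI] with s hs
    exact hR.norm_pow_le (ofReal_mul_mem_openSector hzm hs.1) (by omega)
  have h2 : Tendsto (fun s : ℝ => (R (((1 - s : ℝ) : ℂ) * (z / m)) ^ m)
      ((R ((s : ℂ) * (z / n)) ^ n) x)) (𝓝[>] 0) (𝓝 ((R (z / m) ^ m) x)) := by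
    refine tendsto_apply_of_norm_le ?_ (hone hzm) (hR.tendsto_pow_apply hR₀ hzn _ n)
    filter_upwards [hI] with s hs
    exact hR.norm_pow_le (ofReal_mul_mem_openSector hzm (by linarith [hs.2])) (by omega)
  refine le_of_tendsto (h1.sub h2).norm ?_
  filter_upwards [hI] with s hs
  have hs' : 1 - s ∈ Set.Ioo (0 : ℝ) 1 := ⟨by linarith [hs.2], by linarith [hs.1]⟩
  have h := hR.norm_interpolation_sub_le hθ hρ hz hm hn hs hs'
  rw [sub_sub_cancel] at h
  exact ContinuousLinearMap.le_of_opNorm_le _ h x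

theorem exists_tendstoLocallyUniformlyOn (hθ : θ < Real.pi / 2) (hR : IsContractiveResolvent θ R)
    (hR₀ : ∀ z ∈ openSector θ, ∀ x, Tendsto (fun s : ℝ => R (s * z) x) (𝓝[>] 0) (𝓝 x)) :
    ∃ U : ℂ → H →L[ℂ] H, U 0 = 1 ∧
      TendstoLocallyUniformlyOn (fun (n : ℕ) z => R (z / n) ^ n) U atTop (openSector θ) := by
  have hS := isOpen_openSector hθ
  have hball : ∀ z ∈ openSector θ, ∃ ρ > 0, Metric.closedBall z ρ ⊆ openSector θ := fun z hz =>
    Metric.nhds_basis_closedBall.mem_iff.1 (hS.mem_nhds hz)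
  -- Off the sector the limit is assigned the value `1`, which serves to give `U 0 = 1`.
  have hlim : ∀ z : ℂ, ∃ u : H →L[ℂ] H, (z = 0 → u = 1) ∧
      (z ∈ openSector θ → Tendsto (fun n : ℕ => R (z / n) ^ n) atTop (𝓝 u)) := by
    intro z
    by_cases hz : z ∈ openSector θ
    · obtain ⟨ρ, hρ, hsub⟩ := hball z hz
      have hcs : CauchySeq fun n : ℕ => R (z / n) ^ n := by
        refine Metric.cauchySeq_iff'.2 fun ε hε => ?_
        have h0 : Tendsto (fun n : ℕ => 64 * ‖z‖ ^ 2 / ρ ^ 2 * (2 * (1 / (n : ℝ)))) atTop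
            (𝓝 0) := by
          have := (tendsto_one_div_atTop_nhds_zero_nat.const_mul 2).const_mul
            (64 * ‖z‖ ^ 2 / ρ ^ 2)
          rwa [mul_zero, mul_zero] at this
        obtain ⟨N, hN, hN3⟩ := ((h0.eventually_lt_const hε).and (eventually_ge_atTop 3)).exists
        refine ⟨N, fun n hn => ?_⟩
        rw [dist_eq_norm]
        refine (hR.norm_pow_sub_pow_le hθ hR₀ hρ hsub hN3 (hN3.trans hn)).trans_lt
          (lt_of_le_of_lt ?_ hN)
        have hN0 : (0 : ℝ) < N := by exact_mod_cast (by omega : 0 < N)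
        have hnN : (N : ℝ) ≤ n := by exact_mod_cast hn
        have : 1 / (n : ℝ) ≤ 1 / N := one_div_le_one_div_of_le hN0 hnN
        gcongr
        linarith
      obtain ⟨u, hu⟩ := cauchySeq_tendsto_of_complete hcs
      exact ⟨u, fun h => absurd h hz.1, fun _ => hu⟩
    · exact ⟨1, fun _ => rfl, fun h => absurd h hz⟩
  choose U hU0 hU using hlim
  refine ⟨U, hU0 0 rfl, Metric.tendstoLocallyUniformlyOn_iff.2 fun ε hε z hz => ?_⟩
  obtain ⟨ρ, hρ, hsub⟩ := hball z hz
  refine ⟨Metric.ball z (ρ / 2), mem_nhdsWithin_of_mem_nhds (Metric.ball_mem_nhds z (by positivity)),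
    ?_⟩
  have h0 : Tendsto (fun n : ℕ => 64 * (‖z‖ + ρ) ^ 2 / (ρ / 2) ^ 2 * (1 / (n : ℝ))) atTop
      (𝓝 0) := by
    have := tendsto_one_div_atTop_nhds_zero_nat.const_mul (64 * (‖z‖ + ρ) ^ 2 / (ρ / 2) ^ 2)
    rwa [mul_zero] at this
  filter_upwards [h0.eventually_lt_const hε, eventually_ge_atTop 3] with n hn hn3 y hy
  refine lt_of_le_of_lt ?_ hn
  rw [Metric.mem_ball, dist_eq_norm] at hy
  -- Halving the radius gives every `y` near `z` the same disc size, so letting `m → ∞` in the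
  -- Cauchy bound gives a rate uniform in `y`.
  have hysub : Metric.closedBall y (ρ / 2) ⊆ openSector θ := by
    refine (Metric.closedBall_subset_closedBall' ?_).trans hsub
    rw [dist_eq_norm]
    linarith
  have hyS := hysub (Metric.mem_closedBall_self (by positivity))
  have hylim : Tendsto (fun m : ℕ => 64 * ‖y‖ ^ 2 / (ρ / 2) ^ 2 * (1 / (n : ℝ) + 1 / m)) atTop
      (𝓝 (64 * ‖y‖ ^ 2 / (ρ / 2) ^ 2 * (1 / n))) := by
    simpa using (tendsto_one_div_atTop_nhds_zero_nat.const_add (1 / (n : ℝ))).const_mul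
      (64 * ‖y‖ ^ 2 / (ρ / 2) ^ 2)
  have h1 : ‖R (y / n) ^ n - U y‖ ≤ 64 * ‖y‖ ^ 2 / (ρ / 2) ^ 2 * (1 / n) := by
    refine le_of_tendsto_of_tendsto (tendsto_const_nhds.sub (hU y hyS)).norm hylim ?_
    filter_upwards [eventually_ge_atTop 3] with m hm
    exact hR.norm_pow_sub_pow_le hθ hR₀ (by positivity) hysub hm hn3
  have h2 : ‖y‖ ≤ ‖z‖ + ρ := by
    have := norm_le_norm_add_norm_sub' y z
    linarith
  rw [dist_comm, dist_eq_norm]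
  refine h1.trans ?_
  gcongr

theorem norm_limit_le (hR : IsContractiveResolvent θ R) (hz : z ∈ openSector θ)
    {u : H →L[ℂ] H} (hu : Tendsto (fun n : ℕ => R (z / n) ^ n) atTop (𝓝 u)) : ‖u‖ ≤ 1 := by
  refine le_of_tendsto hu.norm ?_
  filter_upwards [eventually_ge_atTop 1] with n hn
  exact hR.norm_pow_le (div_natCast_mem_openSector hz (by omega)) hn

theorem differentiableOn_pow (hθ : θ < Real.pi / 2) (hR : IsContractiveResolvent θ R) :
    ∀ᶠ n : ℕ in atTop, DifferentiableOn ℂ (fun z => R (z / n) ^ n) (openSector θ) := by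
  filter_upwards [eventually_ge_atTop 1] with n hn z hz
  have h := (hR.hasDerivAt_pow hθ (div_natCast_mem_openSector hz (by omega : n ≠ 0)) n)
  exact (h.scomp z ((hasDerivAt_id z).div_const
    (n : ℂ))).differentiableAt.differentiableWithinAt

/-- Weierstrass: locally uniform limits of holomorphic functions may be differentiated termwise. -/
theorem tendsto_deriv (hθ : θ < Real.pi / 2) (hR : IsContractiveResolvent θ R)
    (hU : TendstoLocallyUniformlyOn (fun (n : ℕ) z => R (z / n) ^ n) U atTop (openSector θ))
    (hz : z ∈ openSector θ) :
    Tendsto (fun n : ℕ => -(cofactor R (z / n) * R (z / n) ^ n)) atTop (𝓝 (deriv U z)) := by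
  have h := (hU.deriv (hR.differentiableOn_pow hθ) (isOpen_openSector hθ)).tendsto_at hz
  refine h.congr' ?_
  filter_upwards [eventually_ge_atTop 1] with n hn
  have hn0 : (n : ℂ) ≠ 0 := by exact_mod_cast (by omega : n ≠ 0)
  have h1 := hR.hasDerivAt_pow hθ (div_natCast_mem_openSector hz (by omega : n ≠ 0)) n
  have h2 := h1.scomp z ((hasDerivAt_id z).div_const (n : ℂ))
  rw [Function.comp_apply]
  refine h2.deriv.trans ?_
  rw [smul_neg, smul_smul, one_div_mul_cancel hn0, one_smul]

/-- For the approximants, the difference of the two sides is `(z - w) / n` times the product of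
their derivatives. That product converges, so the difference vanishes in the limit. -/
theorem deriv_limit_mul (hθ : θ < Real.pi / 2) (hR : IsContractiveResolvent θ R)
    (hU : TendstoLocallyUniformlyOn (fun (n : ℕ) z => R (z / n) ^ n) U atTop (openSector θ))
    (hz : z ∈ openSector θ) (hw : w ∈ openSector θ) :
    deriv U z * U w = U z * deriv U w := by
  have hz1 := hU.tendsto_at hz
  have hw1 := hU.tendsto_at hw
  have hz2 := hR.tendsto_deriv hθ hU hz
  have hw2 := hR.tendsto_deriv hθ hU hw
  rw [← sub_eq_zero]
  refine tendsto_nhds_unique ((hz2.mul hw1).sub (hz1.mul hw2)) ?_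
  have h0 : Tendsto (fun n : ℕ => (z - w) / n) atTop (𝓝 0) := tendsto_const_div_atTop_nhds_zero_nat _
  have h1 := h0.smul (hz2.mul hw2)
  rw [zero_smul] at h1
  refine h1.congr' ?_
  filter_upwards [eventually_ge_atTop 1] with n hn
  have hzn := div_natCast_mem_openSector hz (by omega : n ≠ 0)
  have hwn := div_natCast_mem_openSector hw (by omega : n ≠ 0)
  have hc1 := (hR.commute_cofactor hzn hwn).pow_left n
  rw [sub_div, neg_mul_neg, neg_mul, mul_neg, sub_neg_eq_add]
  have e1 : cofactor R (z / n) * R (z / n) ^ n * (cofactor R (w / n) * R (w / n) ^ n) =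
      cofactor R (z / n) * cofactor R (w / n) * (R (z / n) ^ n * R (w / n) ^ n) := by
    rw [mul_assoc (cofactor R (z / n)), ← mul_assoc (R (z / n) ^ n), hc1.eq]
    simp only [mul_assoc]
  have e2 : R (z / n) ^ n * (cofactor R (w / n) * R (w / n) ^ n) =
      cofactor R (w / n) * (R (z / n) ^ n * R (w / n) ^ n) := by
    rw [← mul_assoc, hc1.eq, mul_assoc]
  rw [e1, e2, ← neg_sub, neg_smul, ← smul_mul_assoc, ← hR.cofactor_sub hzn hwn, mul_assoc, sub_mul]
  abel

end IsContractiveResolvent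

/-! ### Resolvents of m-sectorial operators -/

variable {H : Type*} [NormedAddCommGroup H] [InnerProductSpace ℂ H]

theorem isBoundedInverse_boundedInverse {T : H →ₗ.[ℂ] H} (h : HasBoundedInverse T) :
    IsBoundedInverse T (boundedInverse T) := by
  rw [boundedInverse, dif_pos h]
  exact h.choose_spec

theorem IsBoundedInverse.eq {T : H →ₗ.[ℂ] H} {R R' : H →L[ℂ] H} (h : IsBoundedInverse T R)
    (h' : IsBoundedInverse T R') : R = R' := by
  ext y
  obtain ⟨hy, e⟩ := h'.1 y
  have := h.2 ⟨R' y, hy⟩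
  rwa [e] at this

theorem isBoundedInverse_constAdd_iff {ζ : ℂ} {A : H →ₗ.[ℂ] H} {R : H →L[ℂ] H} :
    IsBoundedInverse (constAdd ζ A) R ↔
      (∀ y : H, ∃ h : R y ∈ A.domain, ζ • R y + A ⟨R y, h⟩ = y) ∧
        ∀ x : A.domain, R (ζ • (x : H) + A x) = x :=
  Iff.rfl

theorem isBoundedInverse_onePlus_iff {s : ℂ} (hs : s ≠ 0) {A : H →ₗ.[ℂ] H} {R : H →L[ℂ] H} :
    IsBoundedInverse (onePlus s A) R ↔
      (∀ y : H, ∃ h : R y ∈ A.domain, R y + s • A ⟨R y, h⟩ = y) ∧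
        ∀ x : A.domain, R ((x : H) + s • A x) = x := by
  rw [onePlus, if_neg hs, isBoundedInverse_constAdd_iff]
  simp only [one_smul]
  exact Iff.rfl

theorem isBoundedInverse_onePlus_zero (A : H →ₗ.[ℂ] H) : IsBoundedInverse (onePlus 0 A) 1 := by
  rw [onePlus, if_pos rfl]
  exact ⟨fun y => ⟨trivial, rfl⟩, fun x => rfl⟩

theorem boundedInverse_onePlus_zero (A : H →ₗ.[ℂ] H) : boundedInverse (onePlus 0 A) = 1 :=
  (isBoundedInverse_boundedInverse ⟨1, isBoundedInverse_onePlus_zero A⟩).eq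
    (isBoundedInverse_onePlus_zero A)

theorem re_mul_inner_nonneg {A : H →ₗ.[ℂ] H} {α : ℝ} (hα₀ : 0 < α) (hα : α < Real.pi / 2)
    (hA : numericalRange A ⊆ closedSector α) {z : ℂ} (hz : z ∈ openSector (Real.pi / 2 - α))
    (x : A.domain) : 0 ≤ (z * inner ℂ (x : H) (A x)).re := by
  rcases eq_or_ne (x : H) 0 with hx | hx
  · simp [hx]
  have hx' : ‖(x : H)‖ ≠ 0 := norm_ne_zero_iff.2 hx
  set c : ℂ := ((‖(x : H)‖⁻¹ : ℝ) : ℂ) with hc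
  have hmem : inner ℂ ((c • x : A.domain) : H) (A (c • x)) ∈ numericalRange A := by
    refine ⟨c • x, ?_, rfl⟩
    rw [Submodule.coe_smul, norm_smul, hc, Complex.norm_real, norm_inv, norm_norm,
      inv_mul_cancel₀ hx']
  have h := re_mul_nonneg hα₀ hα hz (hA hmem)
  rw [LinearPMap.map_smul, Submodule.coe_smul, inner_smul_left, inner_smul_right, hc,
    Complex.conj_ofReal, mul_left_comm _ (Complex.ofReal _), mul_left_comm _ (Complex.ofReal _),
    Complex.re_ofReal_mul, Complex.re_ofReal_mul, ← mul_assoc] at h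
  exact nonneg_of_mul_nonneg_right h (by positivity)

namespace IsMSectorial

variable {A : H →ₗ.[ℂ] H} {α : ℝ} {z : ℂ}

/-- `1 + zA = z (z⁻¹ + A)`, and `Re z⁻¹ > 0`. -/
theorem hasBoundedInverse_onePlus (hα₀ : 0 < α) (hA : IsMSectorial A α)
    (hz : z ∈ openSector (Real.pi / 2 - α)) : HasBoundedInverse (onePlus z A) := by
  have hz0 := hz.1
  have hre : 0 < z.re := re_pos_of_mem_openSector (by linarith) hz
  have hinv : 0 < (z⁻¹).re := by
    rw [Complex.inv_re]
    exact div_pos hre (Complex.normSq_pos.2 hz0)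
  obtain ⟨R, hR⟩ := hA.hasBoundedInverse z⁻¹ hinv
  rw [isBoundedInverse_constAdd_iff] at hR
  refine ⟨z⁻¹ • R, (isBoundedInverse_onePlus_iff hz0).2 ⟨fun y => ?_, fun x => ?_⟩⟩
  · obtain ⟨h, e⟩ := hR.1 y
    refine ⟨A.domain.smul_mem _ h, ?_⟩
    have : A ⟨z⁻¹ • R y, A.domain.smul_mem _ h⟩ = z⁻¹ • A ⟨R y, h⟩ :=
      LinearPMap.map_smul A z⁻¹ ⟨R y, h⟩
    change z⁻¹ • R y + z • A ⟨z⁻¹ • R y, A.domain.smul_mem _ h⟩ = y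
    rw [this, smul_inv_smul₀ hz0, e]
  · have := hR.2 x
    change z⁻¹ • R _ = _
    rw [← map_smul, smul_add, inv_smul_smul₀ hz0, this]

theorem isBoundedInverse_resolvent (hα₀ : 0 < α) (hA : IsMSectorial A α)
    (hz : z ∈ openSector (Real.pi / 2 - α)) :
    (∀ y : H, ∃ h : boundedInverse (onePlus z A) y ∈ A.domain,
      boundedInverse (onePlus z A) y + z • A ⟨boundedInverse (onePlus z A) y, h⟩ = y) ∧
        ∀ x : A.domain, boundedInverse (onePlus z A) ((x : H) + z • A x) = x :=
  (isBoundedInverse_onePlus_iff hz.1).1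
    (isBoundedInverse_boundedInverse (hA.hasBoundedInverse_onePlus hα₀ hz))

theorem sq_norm_le_re_inner (hα₀ : 0 < α) (hα : α < Real.pi / 2) (hA : IsMSectorial A α)
    (hz : z ∈ openSector (Real.pi / 2 - α)) (x : A.domain) :
    ‖(x : H)‖ ^ 2 ≤ (inner ℂ (x : H) ((x : H) + z • A x)).re := by
  have := re_mul_inner_nonneg hα₀ hα hA.numericalRange_subset hz x
  have hn : (inner ℂ (x : H) (x : H)).re = ‖(x : H)‖ ^ 2 := inner_self_eq_norm_sq (𝕜 := ℂ) (x : H)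
  rw [inner_add_right, inner_smul_right, Complex.add_re, hn]
  linarith

/-- With `x = R z y`, accretivity of `zA` gives `‖x‖² ≤ Re (x, y) ≤ ‖x‖ ‖y‖`. -/
theorem isContractiveResolvent (hα₀ : 0 < α) (hα : α < Real.pi / 2) (hA : IsMSectorial A α) :
    IsContractiveResolvent (Real.pi / 2 - α) fun z => boundedInverse (onePlus z A) where
  norm_le z hz := by
    refine ContinuousLinearMap.opNorm_le_bound _ zero_le_one fun y => ?_
    obtain ⟨h, e⟩ := (hA.isBoundedInverse_resolvent hα₀ hz).1 y
    have h1 := hA.sq_norm_le_re_inner hα₀ hα hz ⟨_, h⟩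
    rw [e] at h1
    have h2 := h1.trans ((Complex.re_le_norm _).trans (norm_inner_le_norm _ _))
    rw [one_mul]
    by_contra! hlt
    have := norm_nonneg y
    dsimp only at h2 hlt
    nlinarith
  smul_sub_smul a ha b hb := by
    ext y
    obtain ⟨hA1, hA2⟩ := hA.isBoundedInverse_resolvent hα₀ ha
    obtain ⟨h, e⟩ := (hA.isBoundedInverse_resolvent hα₀ hb).1 y
    set R := boundedInverse (onePlus a A)
    set v := boundedInverse (onePlus b A) y
    have h1 := hA2 ⟨v, h⟩
    -- Here `v + b A v = y` eliminates `A v`; applying `R` then gives the resolvent identity.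
    have h2 : b • ((v : H) + a • A ⟨v, h⟩) = a • y + (b - a) • v := by
      rw [← e]
      module
    have h3 := congrArg R h2
    rw [map_smul, h1, map_add, map_smul, map_smul] at h3
    change b • v - a • R y = (b - a) • R v
    rw [h3]
    abel

/-- If `y` is orthogonal to the domain and `x = (1 + A)⁻¹ y`, then `‖x‖² ≤ Re (x, y) = 0`, so `y =
(1 + A) x = 0`. -/
theorem dense_domain [CompleteSpace H] (hα₀ : 0 < α) (hα : α < Real.pi / 2)
    (hA : IsMSectorial A α) : Dense (A.domain : Set H) := by
  rw [Submodule.dense_iff_topologicalClosure_eq_top, Submodule.topologicalClosure_eq_top_iff,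
    Submodule.eq_bot_iff]
  intro y hy
  have h1S : (1 : ℂ) ∈ openSector (Real.pi / 2 - α) := by
    exact_mod_cast ofReal_mem_openSector (sub_pos.2 hα) one_pos
  obtain ⟨h, e⟩ := (hA.isBoundedInverse_resolvent hα₀ h1S).1 y
  have h1 := hA.sq_norm_le_re_inner hα₀ hα h1S ⟨_, h⟩
  rw [e, (Submodule.mem_orthogonal _ _).1 hy _ h, Complex.zero_re] at h1
  have h2 : boundedInverse (onePlus 1 A) y = 0 := by
    rw [← norm_eq_zero]
    exact pow_eq_zero_iff two_ne_zero |>.1 (le_antisymm h1 (sq_nonneg _))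
  have h3 : (⟨boundedInverse (onePlus 1 A) y, h⟩ : A.domain) = 0 := Subtype.ext h2
  rw [h3, h2, LinearPMap.map_zero, smul_zero, add_zero] at e
  exact e.symm

theorem cofactor_apply (hα₀ : 0 < α) (hA : IsMSectorial A α)
    (hz : z ∈ openSector (Real.pi / 2 - α)) (x : A.domain) :
    cofactor (fun z => boundedInverse (onePlus z A)) z x = boundedInverse (onePlus z A) (A x) := by
  have h := (hA.isBoundedInverse_resolvent hα₀ hz).2 x
  rw [map_add, map_smul] at h
  refine smul_right_injective H hz.1 ?_
  change z • (z⁻¹ • ((x : H) - boundedInverse (onePlus z A) x)) = _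
  rw [smul_inv_smul₀ hz.1]
  nth_rewrite 1 [← h]
  abel

end IsMSectorial

/-- Contractions that converge to `1` on a dense set converge strongly. -/
theorem tendsto_of_dense {ι : Type*} {l : Filter ι} {P : ι → H →L[ℂ] H} {s : Set H}
    (hs : Dense s) (hP : ∀ᶠ i in l, ‖P i‖ ≤ 1)
    (h : ∀ x ∈ s, Tendsto (fun i => P i x) l (𝓝 x)) (x : H) :
    Tendsto (fun i => P i x) l (𝓝 x) := by
  refine Metric.tendsto_nhds.2 fun ε hε => ?_
  obtain ⟨y, hy, hxy⟩ := hs.exists_dist_lt x (by positivity : 0 < ε / 3)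
  filter_upwards [hP, Metric.tendsto_nhds.1 (h y hy) (ε / 3) (by positivity)] with i hi hiy
  have h1 : dist (P i x) (P i y) ≤ dist x y := by
    rw [dist_eq_norm, dist_eq_norm, ← map_sub]
    exact ((P i).le_opNorm _).trans (mul_le_of_le_one_left (norm_nonneg _) hi)
  have h2 := dist_triangle4 (P i x) (P i y) y x
  rw [dist_comm y x] at h2
  linarith

namespace IsMSectorial

variable {A : H →ₗ.[ℂ] H} {α : ℝ} {z : ℂ}

theorem norm_resolvent_sub_le (hα₀ : 0 < α) (hα : α < Real.pi / 2) (hA : IsMSectorial A α)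
    (hz : z ∈ openSector (Real.pi / 2 - α)) (x : A.domain) :
    ‖boundedInverse (onePlus z A) x - x‖ ≤ ‖z‖ * ‖A x‖ := by
  have h := (hA.isBoundedInverse_resolvent hα₀ hz).2 x
  rw [map_add, map_smul] at h
  have e : boundedInverse (onePlus z A) x - x = -(z • boundedInverse (onePlus z A) (A x)) := by
    rw [eq_neg_iff_add_eq_zero, ← sub_eq_zero.2 h]
    abel
  rw [e, norm_neg, norm_smul]
  gcongr
  exact (ContinuousLinearMap.le_opNorm _ _).trans (mul_le_of_le_one_left (norm_nonneg _)
    ((hA.isContractiveResolvent hα₀ hα).norm_le _ hz))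

theorem norm_resolvent_pow_sub_le (hα₀ : 0 < α) (hα : α < Real.pi / 2) (hA : IsMSectorial A α)
    (hz : z ∈ openSector (Real.pi / 2 - α)) (x : A.domain) (n : ℕ) :
    ‖(boundedInverse (onePlus z A) ^ n) x - x‖ ≤ n * (‖z‖ * ‖A x‖) := by
  induction n with
  | zero => simp
  | succ n ih =>
    set R := boundedInverse (onePlus z A)
    have e : (R ^ (n + 1)) x - x = R ((R ^ n) x - x) + (R x - x) := by
      rw [pow_succ', mul_apply_eq_comp, map_sub]
      abel
    have h1 : ‖R ((R ^ n) x - x)‖ ≤ ‖(R ^ n) x - x‖ := (R.le_opNorm _).trans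
      (mul_le_of_le_one_left (norm_nonneg _) ((hA.isContractiveResolvent hα₀ hα).norm_le _ hz))
    have h2 := hA.norm_resolvent_sub_le hα₀ hα hz x
    rw [e, Nat.cast_succ]
    refine (norm_add_le _ _).trans ?_
    linarith

theorem tendsto_resolvent [CompleteSpace H] {ι : Type*} {l : Filter ι} {f : ι → ℂ} (hα₀ : 0 < α)
    (hα : α < Real.pi / 2) (hA : IsMSectorial A α)
    (hf : ∀ᶠ i in l, f i ∈ openSector (Real.pi / 2 - α)) (hf₀ : Tendsto f l (𝓝 0)) (x : H) :
    Tendsto (fun i => boundedInverse (onePlus (f i) A) x) l (𝓝 x) := by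
  have hR := hA.isContractiveResolvent hα₀ hα
  refine tendsto_of_dense (P := fun i => boundedInverse (onePlus (f i) A))
    (hA.dense_domain hα₀ hα) (hf.mono fun i hi => hR.norm_le _ hi) (fun x hx => ?_) x
  rw [tendsto_iff_norm_sub_tendsto_zero]
  have h0 : Tendsto (fun i => ‖f i‖ * ‖A ⟨x, hx⟩‖) l (𝓝 0) := by
    simpa using hf₀.norm.mul_const ‖A ⟨x, hx⟩‖
  refine squeeze_zero' (.of_forall fun _ => norm_nonneg _) ?_ h0
  filter_upwards [hf] with i hi
  exact hA.norm_resolvent_sub_le hα₀ hα hi ⟨x, hx⟩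

end IsMSectorial

theorem tendsto_ofReal_mul_nhdsGT_zero (c : ℂ) :
    Tendsto (fun s : ℝ => (s : ℂ) * c) (𝓝[>] 0) (𝓝 0) := by
  have : Continuous fun s : ℝ => (s : ℂ) * c := by fun_prop
  simpa using (this.tendsto 0).mono_left nhdsWithin_le_nhds

/-- Let `w = s c → 0` in `mul_eq_mul_of_deriv_mul_eq`. Keeping `U` and `V` separate serves both the
semigroup law and uniqueness. -/
theorem add_eq_mul_of_deriv_mul_eq {θ : ℝ} (hθ : θ < Real.pi / 2) {U V : ℂ → H →L[ℂ] H}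
    (hU : DifferentiableOn ℂ U (openSector θ)) (hV : DifferentiableOn ℂ V (openSector θ))
    (h : ∀ z ∈ openSector θ, ∀ w ∈ openSector θ, deriv U z * V w = U z * deriv V w)
    (hV₀ : ∀ c ∈ openSector θ, ∀ x, Tendsto (fun s : ℝ => V (s * c) x) (𝓝[>] 0) (𝓝 x))
    {z c : ℂ} (hz : z ∈ openSector θ) (hc : c ∈ openSector θ) : U (z + c) = U z * V c := by
  ext x
  have h1 : Tendsto (fun s : ℝ => U (z + c) (V (s * c) x)) (𝓝[>] 0) (𝓝 (U (z + c) x)) :=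
    ((U (z + c)).continuous.tendsto x).comp (hV₀ c hc x)
  have h2 : Tendsto (fun s : ℝ => U z (V (s * c + c) x)) (𝓝[>] 0) (𝓝 (U z (V c x))) := by
    have hcV : ContinuousAt V (0 + c) := by
      rw [zero_add]
      exact (hV.differentiableAt ((isOpen_openSector hθ).mem_nhds hc)).continuousAt
    have h3 := hcV.tendsto.comp ((tendsto_ofReal_mul_nhdsGT_zero c).add_const c)
    rw [zero_add] at h3
    exact ((U z).continuous.tendsto _).comp (tendsto_clm_apply h3 x)
  refine tendsto_nhds_unique h1 (h2.congr' ?_)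
  filter_upwards [self_mem_nhdsWithin] with s hs
  have := mul_eq_mul_of_deriv_mul_eq hθ hU hV h hz (ofReal_mul_mem_openSector hc hs) hc
  exact (DFunLike.congr_fun this x).symm

/-! ### Uniqueness of the semigroup -/

namespace IsHolomorphicSemigroup

variable {A : H →ₗ.[ℂ] H} {θ : ℝ} {U V : ℂ → H →L[ℂ] H} {z : ℂ}

theorem tendsto_ray (hU : IsHolomorphicSemigroup A θ U) {c : ℂ} (hc : c ∈ openSector θ) (x : H) :
    Tendsto (fun s : ℝ => U (s * c) x) (𝓝[>] 0) (𝓝 x) := by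
  have h1 := hc.2
  have h2 := abs_nonneg c.arg
  -- Strong continuity is assumed only in smaller sectors; the mean of `|arg c|` and `θ` gives one
  -- that contains the ray.
  have hc' : c ∈ openSector ((|c.arg| + θ) / 2) := ⟨hc.1, by linarith⟩
  refine (hU.tendsto_zero ((|c.arg| + θ) / 2) (by linarith) (by linarith) x).comp ?_
  refine tendsto_nhdsWithin_iff.2 ⟨tendsto_ofReal_mul_nhdsGT_zero c, ?_⟩
  filter_upwards [self_mem_nhdsWithin] with s hs
  exact ofReal_mul_mem_openSector hc' hs

theorem tendsto_difference (hθ : θ < Real.pi / 2) (hU : IsHolomorphicSemigroup A θ U)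
    (hz : z ∈ openSector θ) (x : H) :
    Tendsto (fun t : ℝ => t⁻¹ • (U z x - U (z + t) x)) (𝓝[>] 0) (𝓝 (-(deriv U z x))) := by
  have hd := (hU.holomorphic.differentiableAt ((isOpen_openSector hθ).mem_nhds hz)).hasDerivAt
  have h1 : HasDerivAt (fun s : ℝ => U (z + s * 1)) ((1 : ℂ) • deriv U z) 0 :=
    hasDerivAt_comp_line (f := U) (c := z) (v := 1) (t := 0)
      (by rwa [Complex.ofReal_zero, zero_mul, add_zero])
  have h2 := hasDerivAt_iff_tendsto_slope_zero.1 h1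
  have h3 := (tendsto_clm_apply (h2.mono_left (nhdsWithin_mono _ fun t ht => ne_of_gt ht)) x).neg
  rw [one_smul] at h3
  refine h3.congr fun t => ?_
  simp only [zero_add, mul_one, Complex.ofReal_zero, add_zero]
  change -(t⁻¹ • (U (z + t) x - U z x)) = _
  rw [← smul_neg, neg_sub]

/-- Since `U (z + t) = U t * U z`, differentiability at `z` is convergence of the generator's
quotient at `U z x`; hence `U z` maps all of `H` into the domain. -/
theorem exists_apply_eq_neg_deriv (hθ : θ < Real.pi / 2) (hU : IsHolomorphicSemigroup A θ U)
    (hz : z ∈ openSector θ) (x : H) :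
    ∃ h : U z x ∈ A.domain, A ⟨U z x, h⟩ = -(deriv U z x) := by
  refine (hU.generator _ _).2 ((hU.tendsto_difference hθ hz x).congr' ?_)
  filter_upwards [self_mem_nhdsWithin] with t ht
  rw [add_comm z, hU.map_add _ (ofReal_mem_openSector (pos_of_mem_openSector hz) ht) z hz,
    mul_apply_eq_comp]

theorem deriv_apply (hθ : θ < Real.pi / 2) (hU : IsHolomorphicSemigroup A θ U)
    (hz : z ∈ openSector θ) (x : A.domain) : deriv U z x = -(U z (A x)) := by
  have h1 := (hU.generator x (A x)).1 ⟨x.2, rfl⟩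
  have h2 := ((U z).continuous.tendsto _).comp h1
  rw [eq_neg_iff_add_eq_zero, add_comm, ← sub_neg_eq_add, sub_eq_zero]
  refine tendsto_nhds_unique h2 ((hU.tendsto_difference hθ hz x).congr' ?_)
  filter_upwards [self_mem_nhdsWithin] with t ht
  rw [hU.map_add z hz _ (ofReal_mem_openSector (pos_of_mem_openSector hz) ht),
    mul_apply_eq_comp, Function.comp_apply, ← map_sub, (U z).map_smul_of_tower]

/-- A holomorphic semigroup is determined by its generator. -/
theorem eqOn (hθ : θ < Real.pi / 2) (hU : IsHolomorphicSemigroup A θ U)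
    (hV : IsHolomorphicSemigroup A θ V) : Set.EqOn U V (openSector θ) := by
  intro c hc
  have hrel : ∀ z ∈ openSector θ, ∀ w ∈ openSector θ, deriv U z * V w = U z * deriv V w := by
    intro z hz w hw
    ext x
    obtain ⟨h, e⟩ := hV.exists_apply_eq_neg_deriv hθ hw x
    rw [mul_apply_eq_comp, mul_apply_eq_comp, hU.deriv_apply hθ hz ⟨_, h⟩, e, map_neg, neg_neg]
  ext x
  -- `U (s c) U c = U (s c + c) = U (s c) V c`; then `s → 0`.
  refine tendsto_nhds_unique (hU.tendsto_ray hc (U c x)) ((hU.tendsto_ray hc (V c x)).congr' ?_)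
  filter_upwards [self_mem_nhdsWithin] with s hs
  have hsc := ofReal_mul_mem_openSector hc hs
  rw [← mul_apply_eq_comp, ← mul_apply_eq_comp, ← hU.map_add _ hsc _ hc,
    ← add_eq_mul_of_deriv_mul_eq hθ hU.holomorphic hV.holomorphic hrel
      (fun c hc x => hV.tendsto_ray hc x) hsc hc]

end IsHolomorphicSemigroup

/-! ### The limit is the semigroup generated by `-A` -/

namespace IsMSectorial

variable [CompleteSpace H] {A : H →ₗ.[ℂ] H} {α : ℝ} {z : ℂ} {U : ℂ → H →L[ℂ] H}

/-- On the domain, `‖R(z/n)^n x - x‖ ≤ n ‖z/n‖ ‖A x‖ = ‖z‖ ‖A x‖`, uniformly in `n`. Density and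
contractivity do the rest. -/
theorem tendsto_limit_apply (hα₀ : 0 < α) (hα : α < Real.pi / 2) (hA : IsMSectorial A α)
    (hU : ∀ z ∈ openSector (Real.pi / 2 - α),
      Tendsto (fun n : ℕ => boundedInverse (onePlus (z / n) A) ^ n) atTop (𝓝 (U z))) (x : H) :
    Tendsto (fun z => U z x) (𝓝[openSector (Real.pi / 2 - α)] 0) (𝓝 x) := by
  have hR := hA.isContractiveResolvent hα₀ hα
  refine tendsto_of_dense (P := U) (hA.dense_domain hα₀ hα) ?_ (fun x hx => ?_) x
  · filter_upwards [self_mem_nhdsWithin] with z hz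
    exact hR.norm_limit_le hz (hU z hz)
  rw [tendsto_iff_norm_sub_tendsto_zero]
  have h0 : Tendsto (fun z : ℂ => ‖z‖ * ‖A ⟨x, hx⟩‖) (𝓝[openSector (Real.pi / 2 - α)] 0)
      (𝓝 0) := by
    have : Continuous fun z : ℂ => ‖z‖ * ‖A ⟨x, hx⟩‖ := by fun_prop
    simpa using (this.tendsto 0).mono_left nhdsWithin_le_nhds
  refine squeeze_zero' (.of_forall fun _ => norm_nonneg _) ?_ h0
  filter_upwards [self_mem_nhdsWithin] with z hz
  refine le_of_tendsto ((tendsto_clm_apply (hU z hz) x).sub_const x).norm ?_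
  filter_upwards [eventually_ge_atTop 1] with n hn
  have hn0 : (n : ℝ) ≠ 0 := by exact_mod_cast (by omega : n ≠ 0)
  refine (hA.norm_resolvent_pow_sub_le hα₀ hα (div_natCast_mem_openSector hz (by omega))
    ⟨x, hx⟩ n).trans_eq ?_
  rw [norm_div, Complex.norm_natCast]
  field_simp

theorem deriv_limit_apply (hα₀ : 0 < α) (hα : α < Real.pi / 2) (hA : IsMSectorial A α)
    (hU : TendstoLocallyUniformlyOn (fun (n : ℕ) z => boundedInverse (onePlus (z / n) A) ^ n) U
      atTop (openSector (Real.pi / 2 - α)))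
    (hz : z ∈ openSector (Real.pi / 2 - α)) (x : A.domain) :
    deriv U z x = -(U z (A x)) := by
  have hR := hA.isContractiveResolvent hα₀ hα
  have h1 := tendsto_clm_apply (hR.tendsto_deriv (by linarith) hU hz) (x : H)
  have hzn : ∀ᶠ n : ℕ in atTop, z / n ∈ openSector (Real.pi / 2 - α) := by
    filter_upwards [eventually_ge_atTop 1] with n hn
    exact div_natCast_mem_openSector hz (by omega)
  have h2 : Tendsto (fun n : ℕ => (boundedInverse (onePlus (z / n) A) ^ n)
      (boundedInverse (onePlus (z / n) A) (A x))) atTop (𝓝 (U z (A x))) := by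
    refine tendsto_apply_of_norm_le (P := fun n : ℕ => boundedInverse (onePlus (z / n) A) ^ n)
      ?_ (tendsto_clm_apply (hU.tendsto_at hz) _)
      (hA.tendsto_resolvent hα₀ hα hzn (tendsto_const_div_atTop_nhds_zero_nat z) (A x))
    filter_upwards [hzn, eventually_ge_atTop 1] with n hn hn1
    exact hR.norm_pow_le hn hn1
  refine tendsto_nhds_unique h1 (h2.neg.congr' ?_)
  filter_upwards [hzn] with n hn
  rw [← hA.cofactor_apply hα₀ hn x, ← mul_apply_eq_comp,
    ((hR.commute_cofactor hn hn).pow_left n).eq]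
  rfl

theorem tendsto_generator (hα₀ : 0 < α) (hα : α < Real.pi / 2) (hA : IsMSectorial A α)
    (hU₀ : U 0 = 1)
    (hU : TendstoLocallyUniformlyOn (fun (n : ℕ) z => boundedInverse (onePlus (z / n) A) ^ n) U
      atTop (openSector (Real.pi / 2 - α))) (x : A.domain) :
    Tendsto (fun t : ℝ => t⁻¹ • ((x : H) - U (t : ℂ) x)) (𝓝[>] 0) (𝓝 (A x)) := by
  have hR := hA.isContractiveResolvent hα₀ hα
  have hθ : Real.pi / 2 - α < Real.pi / 2 := by linarith
  have hmem : ∀ t : ℝ, 0 < t → (t : ℂ) ∈ openSector (Real.pi / 2 - α) := fun t ht =>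
    ofReal_mem_openSector (sub_pos.2 hα) ht
  have hlim : ∀ y : H, Tendsto (fun t : ℝ => U (t : ℂ) y) (𝓝[>] 0) (𝓝 y) := by
    intro y
    refine (hA.tendsto_limit_apply hα₀ hα (fun z hz => hU.tendsto_at hz) y).comp
      (tendsto_nhdsWithin_iff.2 ⟨by simpa using tendsto_ofReal_mul_nhdsGT_zero 1, ?_⟩)
    filter_upwards [self_mem_nhdsWithin] with t ht
    exact hmem t ht
  have hUd := hU.differentiableOn (hR.differentiableOn_pow hθ) (isOpen_openSector hθ)
  have hd : ∀ t : ℝ, 0 < t → HasDerivAt (fun t : ℝ => U (t : ℂ) x) (-(U t (A x))) t := by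
    intro t ht
    have h1 := (hUd.differentiableAt ((isOpen_openSector hθ).mem_nhds (hmem t ht))).hasDerivAt
    have h2 : HasDerivAt (fun s : ℝ => U (0 + s * 1)) ((1 : ℂ) • deriv U t) t :=
      hasDerivAt_comp_line (by rwa [zero_add, mul_one])
    simp only [zero_add, mul_one, one_smul] at h2
    rw [← hA.deriv_limit_apply hα₀ hα hU (hmem t ht) x]
    exact (((ContinuousLinearMap.apply ℂ H (x : H)).restrictScalars ℝ).hasFDerivAt).comp_hasDerivAt
      t h2
  -- For `t > 0` the derivative `-U(t) A x` tends to `-A x`, and a limit of derivatives at the end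
  -- of an interval is the one-sided derivative there.
  have h3 : HasDerivWithinAt (fun t : ℝ => U (t : ℂ) x) (-(A x)) (Set.Ici 0) 0 := by
    refine hasDerivWithinAt_Ici_of_tendsto_deriv (s := Set.Ioi 0)
      (fun t ht => (hd t ht).differentiableAt.differentiableWithinAt) ?_ self_mem_nhdsWithin ?_
    · have := hlim x
      rw [ContinuousWithinAt, Complex.ofReal_zero, hU₀]
      exact this
    · refine (hlim (A x)).neg.congr' ?_
      filter_upwards [self_mem_nhdsWithin] with t ht
      exact (hd t ht).deriv.symm
  have h4 := (hasDerivWithinAt_iff_tendsto_slope' (by simp)).1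
    (h3.mono (Set.Ioi_subset_Ici_self))
  have h5 := h4.neg
  rw [neg_neg] at h5
  refine h5.congr fun t => ?_
  rw [slope, vsub_eq_sub, sub_zero, Complex.ofReal_zero, hU₀, ← smul_neg, neg_sub]
  rfl

theorem isHolomorphicSemigroup (hα₀ : 0 < α) (hα : α < Real.pi / 2) (hA : IsMSectorial A α)
    (hU₀ : U 0 = 1)
    (hU : TendstoLocallyUniformlyOn (fun (n : ℕ) z => boundedInverse (onePlus (z / n) A) ^ n) U
      atTop (openSector (Real.pi / 2 - α))) :
    IsHolomorphicSemigroup A (Real.pi / 2 - α) U := by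
  have hR := hA.isContractiveResolvent hα₀ hα
  have hθ : Real.pi / 2 - α < Real.pi / 2 := by linarith
  have hUd := hU.differentiableOn (hR.differentiableOn_pow hθ) (isOpen_openSector hθ)
  have hlim := hA.tendsto_limit_apply hα₀ hα (fun z hz => hU.tendsto_at hz)
  refine ⟨hU₀, fun z hz w hw => ?_, hUd, fun θ' _ hθ' x => ?_, fun x y => ⟨?_, fun h => ?_⟩⟩
  · refine add_eq_mul_of_deriv_mul_eq hθ hUd hUd
      (fun z hz w hw => hR.deriv_limit_mul hθ hU hz hw) (fun c hc x => ?_) hz hw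
    refine (hlim x).comp (tendsto_nhdsWithin_iff.2 ⟨tendsto_ofReal_mul_nhdsGT_zero c, ?_⟩)
    filter_upwards [self_mem_nhdsWithin] with s hs
    exact ofReal_mul_mem_openSector hc hs
  · exact (hlim x).mono_left (nhdsWithin_mono _ fun z hz => ⟨hz.1, hz.2.trans hθ'⟩)
  · rintro ⟨h, rfl⟩
    exact hA.tendsto_generator hα₀ hα hU₀ hU ⟨x, h⟩
  -- The generator is no larger than `-A`: `J = (1 + A)⁻¹` commutes with `U t`, so applying `J` to
  -- the quotient gives `A J x = J y`. Hence `x = J x + A J x = J (x + y)` lies in the domain, and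
  -- `A x = y`.
  · have h1S : (1 : ℂ) ∈ openSector (Real.pi / 2 - α) := by
      exact_mod_cast ofReal_mem_openSector (sub_pos.2 hα) one_pos
    have hJ := (hA.isBoundedInverse_resolvent hα₀ h1S).1
    set J := boundedInverse (onePlus 1 A) with hJdef
    have hcomm : ∀ t : ℝ, 0 < t → J * U t = U t * J := by
      intro t ht
      have htS := ofReal_mem_openSector (sub_pos.2 hα) ht
      have hl := hU.tendsto_at htS
      refine tendsto_nhds_unique (hl.const_mul J) ((hl.mul_const J).congr' ?_)
      filter_upwards [eventually_ge_atTop 1] with n hn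
      exact (((hR.commute h1S (div_natCast_mem_openSector htS
        (by omega : n ≠ 0))).pow_right n).eq).symm
    obtain ⟨hx, ex⟩ := hJ x
    have h1 := hA.tendsto_generator hα₀ hα hU₀ hU ⟨J x, hx⟩
    have h2 := (J.continuous.tendsto y).comp h
    have h3 : A ⟨J x, hx⟩ = J y := by
      refine tendsto_nhds_unique h1 (h2.congr' ?_)
      filter_upwards [self_mem_nhdsWithin] with t ht
      rw [Function.comp_apply, J.map_smul_of_tower, map_sub, ← mul_apply_eq_comp, hcomm t ht,
        mul_apply_eq_comp]
    rw [h3, one_smul, ← map_add] at ex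
    obtain ⟨hxy, exy⟩ := hJ (x + y)
    simp only [ex, one_smul, add_right_inj] at exy
    exact ⟨ex ▸ hxy, exy⟩

end IsMSectorial
end EulerFormula

end

theorem corollary3 {H : Type*} [NormedAddCommGroup H] [InnerProductSpace ℂ H] [CompleteSpace H]
    (A : H →ₗ.[ℂ] H) (α : ℝ) (hα₀ : 0 < α) (hα : α < Real.pi / 2)
    (hA : EulerFormula.IsMSectorial A α) :
    (∃ U : ℂ → H →L[ℂ] H, EulerFormula.IsHolomorphicSemigroup A (Real.pi / 2 - α) U) ∧
    (∀ t ∈ insert 0 (EulerFormula.openSector (Real.pi / 2 - α)), ∀ n : ℕ, 1 ≤ n →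
      EulerFormula.HasBoundedInverse (EulerFormula.onePlus (t / n) A)) ∧
    (∀ U : ℂ → H →L[ℂ] H, EulerFormula.IsHolomorphicSemigroup A (Real.pi / 2 - α) U →
      ∀ t ∈ insert 0 (EulerFormula.openSector (Real.pi / 2 - α)),
        Tendsto
          (fun n : ℕ => ‖EulerFormula.boundedInverse (EulerFormula.onePlus (t / n) A) ^ n - U t‖)
          atTop (𝓝 0)) := by
  have hθ : Real.pi / 2 - α < Real.pi / 2 := by linarith
  obtain ⟨V, hV₀, hV⟩ :=
    (hA.isContractiveResolvent hα₀ hα).exists_tendstoLocallyUniformlyOn hθ fun z hz x => by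
      refine hA.tendsto_resolvent hα₀ hα ?_ (EulerFormula.tendsto_ofReal_mul_nhdsGT_zero z) x
      filter_upwards [self_mem_nhdsWithin] with s hs
      exact EulerFormula.ofReal_mul_mem_openSector hz hs
  have hVs := hA.isHolomorphicSemigroup hα₀ hα hV₀ hV
  refine ⟨⟨V, hVs⟩, ?_, ?_⟩
  · rintro t (rfl | ht) n hn
    · rw [zero_div]
      exact ⟨1, EulerFormula.isBoundedInverse_onePlus_zero A⟩
    · exact hA.hasBoundedInverse_onePlus hα₀
        (EulerFormula.div_natCast_mem_openSector ht (by omega))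
  · rintro U hU t (rfl | ht)
    · simp [EulerFormula.boundedInverse_onePlus_zero, hU.map_zero]
    · rw [← tendsto_iff_norm_sub_tendsto_zero, hU.eqOn hθ hVs ht]
      exact hV.tendsto_at ht
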